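/- Let $K,M\ge 1$ be integers, and let $\mathcal H_K$ and $\mathcal H_M$ be complex Hilbert spaces of dimensions $K$ and $M$. For a Hermitian operator $X$ on $\mathcal H_K\otimes\mathcal H_M$, let $\lambda_1(X)\le\lambda_2(X)\le\dots\le\lambda_{KM}(X)$ be its eigenvalues, repeated according to multiplicity, and let $\lambda_{\max}^{\otimes}(X)$ and $\lambda_{\min}^{\otimes}(X)$ be the maximum and the minimum of its product numerical range $$\Lambda^{\otimes}(X)=\{\langle a\otimes b,\,X(a\otimes b)\rangle : a\in\mathcal H_K,\ b\in\mathcal H_M,\ \|a\|=\|b\|=1\}\subset\mathbb R.$$ Then the following hold. (1) For every Hermitian $X$ on $\mathcal H_K\otimes\mathcal H_M$, the maximum and the minimum exist, and $$\lambda_{\max}^{\otimes}(X)\ \ge\ \lambda_{K+M-1}(X),\qquad \lambda_{\min}^{\otimes}(X)\ \le\ \lambda_{(K-1)(M-1)+1}(X).$$ (2) If $K,M\ge 2$, these bounds are optimal: there exist Hermitian operators $X_1$ and $X_2$ on $\mathcal H_K\otimes\mathcal H_M$ with $$\lambda_{\max}^{\otimes}(X_1)<\lambda_{K+M}(X_1),\qquad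 \lambda_{\min}^{\otimes}(X_2)>\lambda_{(K-1)(M-1)}(X_2).$$ (3) For all orthonormal bases $e_1,\dots,e_K$ of $\mathcal H_K$ and $f_1,\dots,f_M$ of $\mathcal H_M$, the subspace of $\mathcal H_K\otimes\mathcal H_M$ spanned by the vectors $e_i\otimes f_j+e_{i+1}\otimes f_{j+1}$ with $1\le i<K$ and $1\le j<M$ has dimension $(K-1)(M-1)$ and contains no product vector $a\otimes b$ with $a\ne 0$ and $b\ne 0$. -/

import Mathlib

open scoped TensorProduct

namespace ProductRange

variable {HK HM : Type*}
  [NormedAddCommGroup HK] [InnerProductSpace ℂ HK]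
  [NormedAddCommGroup HM] [InnerProductSpace ℂ HM]

/-- The product numerical range of an operator `X` on `HK ⊗ HM`: all values
`⟨a ⊗ b, X (a ⊗ b)⟩` with `a` and `b` unit vectors. -/
def productNumericalRange (X : HK ⊗[ℂ] HM →ₗ[ℂ] HK ⊗[ℂ] HM) : Set ℂ :=
  {z | ∃ (a : HK) (b : HM), ‖a‖ = 1 ∧ ‖b‖ = 1 ∧ z = inner ℂ (a ⊗ₜ[ℂ] b) (X (a ⊗ₜ[ℂ] b))}

/-- The product numerical range as a set of real numbers (for Hermitian `X` all its elements
are real, so that taking real parts loses nothing). -/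
def realProductRange (X : HK ⊗[ℂ] HM →ₗ[ℂ] HK ⊗[ℂ] HM) : Set ℝ :=
  Complex.re '' productNumericalRange X

/-- The product maximum of a Hermitian operator. -/
noncomputable def productMax (X : HK ⊗[ℂ] HM →ₗ[ℂ] HK ⊗[ℂ] HM) : ℝ :=
  sSup (realProductRange X)

/-- The product minimum of a Hermitian operator. -/
noncomputable def productMin (X : HK ⊗[ℂ] HM →ₗ[ℂ] HK ⊗[ℂ] HM) : ℝ :=
  sInf (realProductRange X)

/-- `orderedEigenvalue hX hn i _ _` is the eigenvalue `λ_i` of a Hermitian operator on an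
`n`-dimensional space, where `λ_1 ≤ λ_2 ≤ ⋯ ≤ λ_n` are all the eigenvalues, repeated according
to multiplicity. Mathlib lists them in decreasing order with indices `0, …, n - 1`, so that
`λ_i` has index `n - i` there. -/
noncomputable def orderedEigenvalue {E : Type*} [NormedAddCommGroup E] [InnerProductSpace ℂ E]
    [FiniteDimensional ℂ E] {X : E →ₗ[ℂ] E} (hX : X.IsSymmetric) {n : ℕ}
    (hn : Module.finrank ℂ E = n) (i : ℕ) (h1 : 1 ≤ i) (hi : i ≤ n) : ℝ :=
  hX.eigenvalues hn ⟨n - i, by omega⟩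

/-- The subspace spanned by the vectors `e_i ⊗ f_j + e_{i+1} ⊗ f_{j+1}`. -/
def diagonalPairSpan {K M : ℕ} (e : OrthonormalBasis (Fin K) ℂ HK)
    (f : OrthonormalBasis (Fin M) ℂ HM) : Submodule ℂ (HK ⊗[ℂ] HM) :=
  Submodule.span ℂ {v | ∃ (i i' : Fin K) (j j' : Fin M),
    (i' : ℕ) = i + 1 ∧ (j' : ℕ) = j + 1 ∧ v = e i ⊗ₜ[ℂ] f j + e i' ⊗ₜ[ℂ] f j'}

theorem finrank_tensor {K M : ℕ} (hK : Module.finrank ℂ HK = K) (hM : Module.finrank ℂ HM = M) :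
    Module.finrank ℂ (HK ⊗[ℂ] HM) = K * M := by
  rw [Module.finrank_tensorProduct, hK, hM]

theorem add_sub_one_le_mul {K M : ℕ} (hK : 1 ≤ K) (hM : 1 ≤ M) : K + M - 1 ≤ K * M := by
  obtain ⟨k, rfl⟩ := Nat.exists_eq_add_of_le hK
  obtain ⟨m, rfl⟩ := Nat.exists_eq_add_of_le hM
  have : 1 + k + (1 + m) ≤ (1 + k) * (1 + m) + 1 := by nlinarith [Nat.zero_le (k * m)]
  omega

theorem pred_mul_pred_add_one_le_mul {K M : ℕ} (hK : 1 ≤ K) (hM : 1 ≤ M) :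
    (K - 1) * (M - 1) + 1 ≤ K * M := by
  obtain ⟨k, rfl⟩ := Nat.exists_eq_add_of_le hK
  obtain ⟨m, rfl⟩ := Nat.exists_eq_add_of_le hM
  simp only [Nat.add_sub_cancel_left]
  nlinarith [Nat.zero_le (k * m)]

theorem add_le_mul_of_two_le {K M : ℕ} (hK : 2 ≤ K) (hM : 2 ≤ M) : K + M ≤ K * M := by
  nlinarith

theorem one_le_pred_mul_pred {K M : ℕ} (hK : 2 ≤ K) (hM : 2 ≤ M) : 1 ≤ (K - 1) * (M - 1) :=
  Nat.mul_pos (by omega) (by omega)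

theorem pred_mul_pred_le_mul (K M : ℕ) : (K - 1) * (M - 1) ≤ K * M :=
  Nat.mul_le_mul (Nat.sub_le K 1) (Nat.sub_le M 1)

end ProductRange

/-!
The two bounds rest on the fact that a subspace `U` of `HK ⊗ HM` of dimension greater than
`(K - 1) (M - 1)` contains a nonzero product vector (`exists_tmul_mem_of_lt_finrank`). Such a `U` is the
common kernel of at most `K + M - 2` linear forms, so that the claim is that `K + M - 2` bilinear
forms on `ℂ^K × ℂ^M` have a common zero `(a, b)` with `a ≠ 0` and `b ≠ 0`
(`exists_common_zero_of_bilinear`). This is the projective dimension theorem for the Segre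
variety. It is proved in the ring `S = ℂ[x_i y_j]`: an explicit chain of primes shows that the
irrelevant ideal of `S`, which is `chainIdeal k K M (K + M - 1)`, has height at least `K + M - 1`
(`le_height_chainIdeal`). If the forms had no nontrivial common zero, then by the Nullstellensatz
this ideal would be minimal over the ideal generated by the forms, and by Krull's height theorem
its height would be at most `K + M - 2`.

The eigenvectors for `λ_{K+M-1}, …, λ_{KM}` span a space of dimension `(K - 1) (M - 1) + 1`, on
whose unit vectors the quadratic form of `X` is at least `λ_{K+M-1}`; evaluating it at a product
vector in this space bounds the product maximum. The bound on the product minimum uses the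
eigenvectors for the first `(K - 1) (M - 1) + 1` eigenvalues.

The span `W` of the vectors `e_i ⊗ f_j + e_{i+1} ⊗ f_{j+1}` lies in the kernel of the linear map
`e_i ⊗ f_j ↦ (-1)^i t^(i + M - 1 - j)` into the polynomials, which sends a product vector to a
product of two nonzero polynomials (`tmul_notMem_diagonalPairSpan`). The projections onto `W` and
onto its orthogonal complement show that the bounds are optimal.
-/

namespace ProductRange

/-! ### The Segre ring and Krull's height theorem -/

section Segre

open MvPolynomial

variable (k : Type*) [Field k] (K M : ℕ)

/-- The homomorphism `z_{ij} ↦ x_i y_j` defining the Segre embedding of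
`ℙ^{K-1} × ℙ^{M-1}`; the variables `x_i` and `y_j` are indexed by the two summands of
`Fin K ⊕ Fin M`. -/
noncomputable def segreHom :
    MvPolynomial (Fin K × Fin M) k →ₐ[k] MvPolynomial (Fin K ⊕ Fin M) k :=
  aeval fun p => X (Sum.inl p.1) * X (Sum.inr p.2)

/-- The homogeneous coordinate ring of the Segre variety, realized as the subalgebra generated
by the products `x_i y_j`. -/
noncomputable abbrev SegreRing : Type _ := (segreHom k K M).range

/-- The generator `x_i y_j` of the Segre ring. -/
noncomputable def segreVar (i : Fin K) (j : Fin M) : SegreRing k K M :=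
  (segreHom k K M).rangeRestrict (X (i, j))

variable {k K M}

theorem coe_segreVar (i : Fin K) (j : Fin M) :
    (segreVar k K M i j : MvPolynomial (Fin K ⊕ Fin M) k) = X (Sum.inl i) * X (Sum.inr j) := by
  exact aeval_X _ _

/-- The Segre relations: the matrix `(x_i y_j)` has vanishing `2 × 2` minors. -/
theorem segreVar_mul_segreVar (i i' : Fin K) (j j' : Fin M) :
    segreVar k K M i j * segreVar k K M i' j' = segreVar k K M i j' * segreVar k K M i' j := by
  apply Subtype.ext
  push_cast
  simp only [coe_segreVar]
  ring

instance : IsNoetherianRing (SegreRing k K M) :=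
  isNoetherianRing_of_surjective _ _ (segreHom k K M).rangeRestrict.toRingHom
    (segreHom k K M).rangeRestrict_surjective

/-- The order in which the variables are set to zero to produce a chain of primes: first all the
`y_j` but the last, then all the `x_i`. The last `y_j` gets a position beyond the end of the
chain. -/
def killOrder : Fin K ⊕ Fin M → ℕ :=
  Sum.elim (fun i => M - 1 + i) (fun j => if (j : ℕ) + 1 = M then K + M else j)

/-- The substitution setting the first `n` variables, in the order `killOrder`, to zero. -/
noncomputable def killHom (n : ℕ) :
    MvPolynomial (Fin K ⊕ Fin M) k →ₐ[k] MvPolynomial (Fin K ⊕ Fin M) k :=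
  aeval fun v => if killOrder v < n then 0 else X v

variable (k K M) in
/-- The prime ideal of the elements of the Segre ring which vanish when the first `n` variables
are set to zero. -/
noncomputable def chainIdeal (n : ℕ) : Ideal (SegreRing k K M) :=
  RingHom.ker ((killHom n).comp (segreHom k K M).range.val)

instance (n : ℕ) : (chainIdeal k K M n).IsPrime := RingHom.ker_isPrime _

theorem mem_chainIdeal {n : ℕ} {s : SegreRing k K M} :
    s ∈ chainIdeal k K M n ↔ killHom n (s : MvPolynomial (Fin K ⊕ Fin M) k) = 0 := Iff.rfl

theorem killHom_comp {m n : ℕ} (h : m ≤ n) :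
    (killHom n).comp (killHom m) = (killHom n : MvPolynomial (Fin K ⊕ Fin M) k →ₐ[k] _) := by
  refine algHom_ext fun v => ?_
  by_cases hv : killOrder v < m
  · simp [killHom, hv, hv.trans_le h]
  · simp [killHom, hv]

theorem chainIdeal_mono {m n : ℕ} (h : m ≤ n) : chainIdeal k K M m ≤ chainIdeal k K M n := by
  intro s hs
  rw [mem_chainIdeal] at hs ⊢
  rw [← killHom_comp h, AlgHom.comp_apply, hs, map_zero]

theorem segreVar_mem_chainIdeal {n : ℕ} {i : Fin K} {j : Fin M} :
    segreVar k K M i j ∈ chainIdeal k K M n ↔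
      killOrder (Sum.inl i : Fin K ⊕ Fin M) < n ∨ killOrder (Sum.inr j : Fin K ⊕ Fin M) < n := by
  rw [mem_chainIdeal, coe_segreVar, map_mul, mul_eq_zero]
  simp only [killHom, aeval_X]
  refine or_congr ?_ ?_ <;> split_ifs with h <;> simp [h]

theorem chainIdeal_lt_succ (hK : 1 ≤ K) (hM : 1 ≤ M) {n : ℕ} (h : n + 1 < K + M) :
    chainIdeal k K M n < chainIdeal k K M (n + 1) := by
  refine lt_of_le_of_ne (chainIdeal_mono n.le_succ) fun heq => ?_
  have key (i : Fin K) (j : Fin M) := (SetLike.ext_iff.mp heq (segreVar k K M i j))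
  simp only [segreVar_mem_chainIdeal, killOrder, Sum.elim_inl, Sum.elim_inr] at key
  -- `n` is the position of some `y_j`, tested on `x_0 y_j`, or of some `x_i`, tested on
  -- `x_i` times the last `y_j`
  by_cases hn : n < M - 1
  · have := key ⟨0, by grind⟩ ⟨n, by omega⟩
    grind
  · have := key ⟨n - (M - 1), by omega⟩ ⟨M - 1, by grind⟩
    grind

theorem le_height_chainIdeal (hK : 1 ≤ K) (hM : 1 ≤ M) {n : ℕ} (h : n < K + M) :
    (n : ℕ∞) ≤ (chainIdeal k K M n).height := by
  induction n with
  | zero => simp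
  | succ n ih =>
    push_cast
    exact (add_le_add_left (ih (by omega)) 1).trans
      (Ideal.height_add_one_le_of_lt_of_isPrime (chainIdeal_lt_succ hK hM h))

/-- A matrix with vanishing `2 × 2` minors is the product of a column and a row. -/
theorem exists_eq_mul_of_minors {ι κ : Type*} (z : ι → κ → k)
    (hz : ∀ i i' j j', z i j * z i' j' = z i j' * z i' j) {i₀ : ι} {j₀ : κ} (h : z i₀ j₀ ≠ 0) :
    ∃ (a : ι → k) (b : κ → k), a ≠ 0 ∧ b ≠ 0 ∧ ∀ i j, z i j = a i * b j := by
  refine ⟨fun i => z i j₀ / z i₀ j₀, z i₀, fun h0 => ?_, fun h0 => h (congrFun h0 j₀),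
    fun i j => ?_⟩
  · simpa [h] using congrFun h0 i₀
  · field_simp
    exact hz i i₀ j j₀

/-- An ideal containing all `x_i y_j` contains every element without constant term, and the
elements of the ideals in the chain have none. -/
theorem chainIdeal_le_of_segreVar_mem (P : Ideal (SegreRing k K M))
    (hP : ∀ i j, segreVar k K M i j ∈ P) (n : ℕ) : chainIdeal k K M n ≤ P := by
  let ε : MvPolynomial (Fin K ⊕ Fin M) k →ₐ[k] k := aeval 0
  have hε : ε.comp (killHom n) = ε := by
    refine algHom_ext fun v => ?_
    by_cases hv : killOrder v < n <;> simp [killHom, hv, ε]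
  -- the class modulo `P` of an element of the Segre ring is its constant term
  have hmk : (Ideal.Quotient.mkₐ k P).comp (segreHom k K M).rangeRestrict =
      (Algebra.ofId k (SegreRing k K M ⧸ P)).comp (ε.comp (segreHom k K M)) := by
    refine algHom_ext fun p => ?_
    have h1 : Ideal.Quotient.mkₐ k P ((segreHom k K M).rangeRestrict (X p)) = 0 :=
      Ideal.Quotient.eq_zero_iff_mem.mpr (hP p.1 p.2)
    rw [AlgHom.comp_apply, h1]
    simp [segreHom, ε]
  intro s hs
  obtain ⟨r, rfl⟩ := (segreHom k K M).rangeRestrict_surjective s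
  have h2 := DFunLike.congr_fun hmk r
  change killHom n (segreHom k K M r) = 0 at hs
  rw [AlgHom.comp_apply, AlgHom.comp_apply, AlgHom.comp_apply, ← hε, AlgHom.comp_apply, hs,
    map_zero, map_zero] at h2
  exact Ideal.Quotient.eq_zero_iff_mem.mp h2

/-- Fewer than `K + M - 1` bilinear forms on `k^K × k^M` over an algebraically closed field have
a common zero `(a, b)` with `a ≠ 0` and `b ≠ 0`. Otherwise, by the Nullstellensatz, the
irrelevant ideal of the Segre ring, which has height at least `K + M - 1`, would be minimal over
an ideal with that few generators, against Krull's height theorem. -/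
theorem exists_common_zero_of_bilinear [IsAlgClosed k] {ι : Type*} [Fintype ι]
    (hK : 1 ≤ K) (hM : 1 ≤ M) (hι : Fintype.card ι + 1 < K + M) (c : ι → Fin K → Fin M → k) :
    ∃ (a : Fin K → k) (b : Fin M → k), a ≠ 0 ∧ b ≠ 0 ∧
      ∀ s, ∑ i, ∑ j, c s i j * (a i * b j) = 0 := by
  by_contra! hno
  let F : ι → MvPolynomial (Fin K × Fin M) k := fun s => ∑ i, ∑ j, C (c s i j) * X (i, j)
  let φ := (segreHom k K M).rangeRestrict
  let I : Ideal (SegreRing k K M) := Ideal.span (Set.range fun s => φ (F s))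
  have hvar (P : Ideal (SegreRing k K M)) (hP : P.IsPrime) (hI : I ≤ P) (i : Fin K) (j : Fin M) :
      segreVar k K M i j ∈ P := by
    have hP' : (P.comap φ).IsPrime := Ideal.comap_isPrime φ P
    change X (i, j) ∈ P.comap φ
    rw [← IsPrime.vanishingIdeal_zeroLocus (K := k) (P.comap φ), mem_vanishingIdeal_iff]
    intro z hz
    rw [mem_zeroLocus_iff] at hz
    by_contra hne
    rw [aeval_X] at hne
    obtain ⟨a, b, ha, hb, hab⟩ := exists_eq_mul_of_minors (fun i j => z (i, j))
      (fun i i' j j' => by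
        have := hz (X (i, j) * X (i', j') - X (i, j') * X (i', j)) (by
          have h0 := segreVar_mul_segreVar (k := k) i i' j j'
          rw [Ideal.mem_comap, map_sub, map_mul, map_mul]
          exact (sub_eq_zero.mpr h0) ▸ P.zero_mem)
        simpa [sub_eq_zero] using this) hne
    obtain ⟨s, hs⟩ := hno a b ha hb
    apply hs
    have := hz (F s) (hI (Ideal.subset_span ⟨s, rfl⟩))
    simpa [F, hab] using this
  have hle : I ≤ chainIdeal k K M (K + M - 1) := by
    rw [Ideal.span_le]
    rintro _ ⟨s, rfl⟩
    simp only [F, map_sum, map_mul, SetLike.mem_coe]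
    refine Ideal.sum_mem _ fun i _ => Ideal.sum_mem _ fun j _ => Ideal.mul_mem_left _ _ ?_
    refine segreVar_mem_chainIdeal.mpr (Or.inl ?_)
    simp only [killOrder, Sum.elim_inl]
    omega
  have hmin : chainIdeal k K M (K + M - 1) ∈ I.minimalPrimes :=
    ⟨⟨inferInstance, hle⟩, fun P hP _ =>
      chainIdeal_le_of_segreVar_mem P (hvar P hP.1 hP.2) _⟩
  have h1 := Ideal.height_le_card_of_mem_minimalPrimes_span (Set.finite_range _) hmin
  have h2 := le_height_chainIdeal (k := k) (K := K) (M := M) hK hM (n := K + M - 1) (by omega)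
  have h3 : K + M - 1 ≤ (Set.range fun s => φ (F s)).ncard := by exact_mod_cast h2.trans h1
  have h4 : (Set.range fun s => φ (F s)).ncard ≤ Fintype.card ι := by
    rw [← Set.image_univ, ← Nat.card_eq_fintype_card, ← Set.ncard_univ]
    exact Set.ncard_image_le
  omega

end Segre

/-! ### Product vectors in subspaces of large dimension -/

section ProductVectors

open Module

/-- Every subspace of `V ⊗ W` of dimension greater than `(dim V - 1) (dim W - 1)` contains a
nonzero product vector: the bilinear forms that cut it out are fewer than `dim V + dim W - 1`. -/
theorem exists_tmul_mem_of_lt_finrank {k V W : Type*} [Field k] [IsAlgClosed k]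
    [AddCommGroup V] [Module k V] [FiniteDimensional k V]
    [AddCommGroup W] [Module k W] [FiniteDimensional k W]
    (hV : 1 ≤ finrank k V) (hW : 1 ≤ finrank k W) (U : Submodule k (V ⊗[k] W))
    (hU : (finrank k V - 1) * (finrank k W - 1) < finrank k U) :
    ∃ (a : V) (b : W), a ≠ 0 ∧ b ≠ 0 ∧ a ⊗ₜ[k] b ∈ U := by
  let e := finBasis k V
  let f := finBasis k W
  let q := finBasis k ((V ⊗[k] W) ⧸ U)
  have hcard : Fintype.card (Fin (finrank k ((V ⊗[k] W) ⧸ U))) + 1 < finrank k V + finrank k W := by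
    have h1 := U.finrank_quotient_add_finrank
    rw [finrank_tensorProduct] at h1
    rw [Fintype.card_fin]
    obtain ⟨m, hm⟩ := Nat.exists_eq_add_of_le hV
    obtain ⟨n, hn⟩ := Nat.exists_eq_add_of_le hW
    rw [hm, hn] at hU h1 ⊢
    simp only [Nat.add_sub_cancel_left] at hU
    have : (1 + m) * (1 + n) = 1 + m + n + m * n := by ring
    omega
  obtain ⟨a, b, ha, hb, hab⟩ := exists_common_zero_of_bilinear hV hW hcard
    fun s i j => q.repr (U.mkQ (e i ⊗ₜ f j)) s
  refine ⟨e.equivFun.symm a, f.equivFun.symm b, e.equivFun.symm.map_ne_zero_iff.mpr ha,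
    f.equivFun.symm.map_ne_zero_iff.mpr hb, ?_⟩
  rw [← Submodule.Quotient.mk_eq_zero, ← Submodule.mkQ_apply, ← q.repr.map_eq_zero_iff]
  ext s
  rw [Finsupp.zero_apply, ← hab s]
  simp only [Basis.equivFun_symm_apply, TensorProduct.sum_tmul, TensorProduct.tmul_sum, map_sum,
    TensorProduct.smul_tmul_smul, map_smul, Finsupp.finsetSum_apply, Finsupp.smul_apply,
    smul_eq_mul]
  rw [Finset.sum_comm]
  exact Finset.sum_congr rfl fun i _ => Finset.sum_congr rfl fun j _ => mul_comm _ _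

end ProductVectors

/-! ### A subspace of maximal dimension without product vectors -/

section DiagonalPairs

open Module Polynomial

variable {HK HM : Type*}
  [NormedAddCommGroup HK] [InnerProductSpace ℂ HK]
  [NormedAddCommGroup HM] [InnerProductSpace ℂ HM]
  {K M : ℕ} (e : OrthonormalBasis (Fin K) ℂ HK) (f : OrthonormalBasis (Fin M) ℂ HM)

/-- The polynomial `∑ i, (-1)^i a_i t^i` of a vector with coordinates `a_i`. -/
noncomputable def alternatingPoly : HK →ₗ[ℂ] ℂ[X] :=
  e.toBasis.constr ℂ fun i => monomial (i : ℕ) ((-1) ^ (i : ℕ))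

/-- The polynomial `∑ j, b_j t^(M-1-j)` of a vector with coordinates `b_j`. -/
noncomputable def reversedPoly : HM →ₗ[ℂ] ℂ[X] :=
  f.toBasis.constr ℂ fun j => monomial (M - 1 - j) 1

theorem alternatingPoly_apply_basis (i : Fin K) :
    alternatingPoly e (e i) = monomial (i : ℕ) ((-1) ^ (i : ℕ)) := by
  rw [alternatingPoly, ← e.coe_toBasis, Basis.constr_basis]

theorem reversedPoly_apply_basis (j : Fin M) :
    reversedPoly f (f j) = monomial (M - 1 - j) 1 := by
  rw [reversedPoly, ← f.coe_toBasis, Basis.constr_basis]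

theorem coeff_alternatingPoly (a : HK) (i : Fin K) :
    (alternatingPoly e a).coeff i = e.repr a i * (-1) ^ (i : ℕ) := by
  simp [alternatingPoly, Basis.constr_apply_fintype, coeff_monomial, Fin.val_inj]

theorem coeff_reversedPoly (b : HM) (j : Fin M) :
    (reversedPoly f b).coeff (M - 1 - j) = f.repr b j := by
  have h (x : Fin M) : M - 1 - (x : ℕ) = M - 1 - j ↔ x = j := by grind
  simp [reversedPoly, Basis.constr_apply_fintype, coeff_monomial, h]

theorem alternatingPoly_ne_zero {a : HK} (ha : a ≠ 0) : alternatingPoly e a ≠ 0 := by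
  contrapose! ha
  rw [← e.repr.map_eq_zero_iff]
  ext i
  simpa [ha] using (coeff_alternatingPoly e a i).symm

theorem reversedPoly_ne_zero {b : HM} (hb : b ≠ 0) : reversedPoly f b ≠ 0 := by
  contrapose! hb
  rw [← f.repr.map_eq_zero_iff]
  ext j
  simpa [hb] using (coeff_reversedPoly f b j).symm

/-- The linear map with `e_i ⊗ f_j ↦ (-1)^i t^(i + M - 1 - j)`, whose coefficients are the
alternating sums of coordinates along the diagonals `i - j = const`. -/
noncomputable def diagonalPoly : HK ⊗[ℂ] HM →ₗ[ℂ] ℂ[X] :=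
  TensorProduct.lift ((LinearMap.mul ℂ ℂ[X]).compl₁₂ (alternatingPoly e) (reversedPoly f))

theorem diagonalPoly_tmul (a : HK) (b : HM) :
    diagonalPoly e f (a ⊗ₜ b) = alternatingPoly e a * reversedPoly f b := by
  simp [diagonalPoly]

theorem diagonalPairSpan_le_ker : diagonalPairSpan e f ≤ LinearMap.ker (diagonalPoly e f) := by
  rw [diagonalPairSpan, Submodule.span_le]
  rintro _ ⟨i, i', j, j', hi, hj, rfl⟩
  rw [SetLike.mem_coe, LinearMap.mem_ker, map_add, diagonalPoly_tmul, diagonalPoly_tmul]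
  simp only [alternatingPoly_apply_basis, reversedPoly_apply_basis, monomial_mul_monomial]
  have h : (i' : ℕ) + (M - 1 - j') = i + (M - 1 - j) := by omega
  rw [h, hi, ← map_add]
  simp [pow_succ]

/-- The span of the vectors `e_i ⊗ f_j + e_{i+1} ⊗ f_{j+1}` contains no nonzero product vector,
as the product of two nonzero polynomials is not zero. -/
theorem tmul_notMem_diagonalPairSpan {a : HK} {b : HM} (ha : a ≠ 0) (hb : b ≠ 0) :
    a ⊗ₜ[ℂ] b ∉ diagonalPairSpan e f := by
  intro h
  have h0 := diagonalPairSpan_le_ker e f h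
  rw [LinearMap.mem_ker, diagonalPoly_tmul] at h0
  exact mul_ne_zero (alternatingPoly_ne_zero e ha) (reversedPoly_ne_zero f hb) h0

/-- The vectors `e_i ⊗ f_j + e_{i+1} ⊗ f_{j+1}`, indexed by `(i, j)` with `i < K` and `j < M`
where `K + 1` and `M + 1` are the dimensions. -/
noncomputable def diagonalPair (e : OrthonormalBasis (Fin (K + 1)) ℂ HK)
    (f : OrthonormalBasis (Fin (M + 1)) ℂ HM) (p : Fin K × Fin M) : HK ⊗[ℂ] HM :=
  e p.1.castSucc ⊗ₜ f p.2.castSucc + e p.1.succ ⊗ₜ f p.2.succ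

theorem diagonalPairSpan_eq_span_range (e : OrthonormalBasis (Fin (K + 1)) ℂ HK)
    (f : OrthonormalBasis (Fin (M + 1)) ℂ HM) :
    diagonalPairSpan e f = Submodule.span ℂ (Set.range (diagonalPair e f)) := by
  rw [diagonalPairSpan]
  congr 1
  ext v
  constructor
  · rintro ⟨i, i', j, j', hi, hj, rfl⟩
    refine ⟨(⟨i, by omega⟩, ⟨j, by omega⟩), ?_⟩
    have hi' : i' = Fin.succ ⟨i, by omega⟩ := Fin.ext hi
    have hj' : j' = Fin.succ ⟨j, by omega⟩ := Fin.ext hj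
    change e i ⊗ₜ[ℂ] f j + e (Fin.succ ⟨i, _⟩) ⊗ₜ[ℂ] f (Fin.succ ⟨j, _⟩) = _
    rw [← hi', ← hj']
  · rintro ⟨p, rfl⟩
    exact ⟨_, _, _, _, rfl, rfl, rfl⟩

theorem linearIndependent_diagonalPair (e : OrthonormalBasis (Fin (K + 1)) ℂ HK)
    (f : OrthonormalBasis (Fin (M + 1)) ℂ HM) :
    LinearIndependent ℂ (diagonalPair e f) := by
  rw [Fintype.linearIndependent_iff]
  intro t ht
  let B := e.toBasis.tensorProduct f.toBasis
  have hB (i j i' j') : B.repr (e i ⊗ₜ f j) (i', j') = if i = i' ∧ j = j' then 1 else 0 := by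
    have : e i ⊗ₜ[ℂ] f j = B (i, j) := by simp [B]
    rw [this, Basis.repr_self, Finsupp.single_apply]
    simp
  -- the coordinate at `(i, j)` of the relation `ht`
  have hcoord (i : Fin (K + 1)) (j : Fin (M + 1)) :
      ∑ p : Fin K × Fin M, t p * ((if p.1.castSucc = i ∧ p.2.castSucc = j then 1 else 0) +
        (if p.1.succ = i ∧ p.2.succ = j then 1 else 0)) = 0 := by
    have := congrArg (fun v => B.repr v (i, j)) ht
    simpa [diagonalPair, hB, Finsupp.finsetSum_apply, mul_add] using this
  -- at `(i, j)` it reads `t (i, j) + t (i - 1, j - 1) = 0`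
  have main : ∀ n : ℕ, ∀ p : Fin K × Fin M, (p.1 : ℕ) = n → t p = 0 := by
    intro n
    induction n with
    | zero =>
      rintro ⟨i, j⟩ hi
      rw [← hcoord i.castSucc j.castSucc, Finset.sum_eq_single (i, j)]
      · have h1 : i.succ ≠ i.castSucc := by simp [Fin.ext_iff]
        simp [h1]
      · rintro ⟨i', j'⟩ - hne
        have h1 : i'.succ ≠ i.castSucc := by simp only [Fin.ne_iff_vne]; simp at hi ⊢; omega
        have h2 : ¬ (i' = i ∧ j' = j) := by simpa using hne
        simp [h1, h2]
      · simp
    | succ n ih =>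
      rintro ⟨i, j⟩ hi
      rw [← hcoord i.castSucc j.castSucc, Finset.sum_eq_single (i, j)]
      · have h1 : i.succ ≠ i.castSucc := by simp [Fin.ext_iff]
        simp [h1]
      · rintro ⟨i', j'⟩ - hne
        by_cases h1 : i'.succ = i.castSucc
        · have h3 : (i' : ℕ) = n := by simp [Fin.ext_iff] at h1 hi; omega
          rw [ih (i', j') h3, zero_mul]
        · have h2 : ¬ (i' = i ∧ j' = j) := by simpa using hne
          simp [h1, h2]
      · simp
  exact fun p => main _ p rfl

theorem finrank_diagonalPairSpan (hK : 1 ≤ K) (hM : 1 ≤ M) :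
    finrank ℂ (diagonalPairSpan e f) = (K - 1) * (M - 1) := by
  obtain ⟨K, rfl⟩ := Nat.exists_eq_add_of_le' hK
  obtain ⟨M, rfl⟩ := Nat.exists_eq_add_of_le' hM
  rw [diagonalPairSpan_eq_span_range, finrank_span_eq_card (linearIndependent_diagonalPair e f)]
  simp

end DiagonalPairs

/-! ### Ordered eigenvalues and quadratic forms on subspaces -/

section MinMax

open Module

variable {E : Type*} [NormedAddCommGroup E] [InnerProductSpace ℂ E] [FiniteDimensional ℂ E]
  {X : E →ₗ[ℂ] E} (hX : X.IsSymmetric) {n : ℕ} (hn : finrank ℂ E = n)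

theorem re_inner_apply_eq_sum (v : E) :
    (inner ℂ v (X v)).re =
      ∑ i, hX.eigenvalues hn i * ‖(hX.eigenvectorBasis hn).repr v i‖ ^ 2 := by
  rw [← (hX.eigenvectorBasis hn).repr.inner_map_map, PiLp.inner_apply, Complex.re_sum]
  refine Finset.sum_congr rfl fun i _ => ?_
  rw [hX.eigenvectorBasis_apply_self_apply]
  rw [RCLike.inner_apply, mul_assoc, RCLike.mul_conj]
  norm_cast

theorem sq_norm_eq_sum (v : E) :
    ‖v‖ ^ 2 = ∑ i, ‖(hX.eigenvectorBasis hn).repr v i‖ ^ 2 := by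
  rw [← (hX.eigenvectorBasis hn).repr.norm_map, EuclideanSpace.norm_sq_eq]

/-- The span of the eigenvectors with index in `s`. -/
noncomputable def eigenSpan (s : Finset (Fin n)) : Submodule ℂ E :=
  Submodule.span ℂ (Set.range fun i : s => hX.eigenvectorBasis hn i)

theorem finrank_eigenSpan (s : Finset (Fin n)) : finrank ℂ (eigenSpan hX hn s) = s.card := by
  rw [eigenSpan, finrank_span_eq_card, Fintype.card_coe]
  exact (hX.eigenvectorBasis hn).orthonormal.linearIndependent.comp _ Subtype.val_injective

theorem repr_eq_zero_of_mem_eigenSpan {s : Finset (Fin n)} {v : E} (hv : v ∈ eigenSpan hX hn s)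
    {i : Fin n} (hi : i ∉ s) : (hX.eigenvectorBasis hn).repr v i = 0 := by
  induction hv using Submodule.span_induction with
  | mem x hx =>
    obtain ⟨j, rfl⟩ := hx
    have : i ≠ j := fun h => hi (h ▸ j.2)
    simp [OrthonormalBasis.repr_self, this]
  | zero => simp
  | add x y _ _ hx hy => simp [hx, hy]
  | smul c x _ hx => simp [hx]

/-- There is a subspace of dimension `n - i + 1` on which the quadratic form of `X` is at least
`λ_i`. -/
theorem exists_submodule_orderedEigenvalue_le (i : ℕ) (h1 : 1 ≤ i) (hi : i ≤ n) :
    ∃ U : Submodule ℂ E, finrank ℂ U = n - i + 1 ∧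
      ∀ v ∈ U, orderedEigenvalue hX hn i h1 hi * ‖v‖ ^ 2 ≤ (inner ℂ v (X v)).re := by
  -- the eigenvalues are listed in decreasing order, so that those up to the index of `λ_i` are
  -- at least `λ_i`
  let c : Fin n := ⟨n - i, by omega⟩
  refine ⟨eigenSpan hX hn (Finset.Iic c), ?_, fun v hv => ?_⟩
  · rw [finrank_eigenSpan, Fin.card_Iic]
  · rw [re_inner_apply_eq_sum hX hn, sq_norm_eq_sum hX hn, Finset.mul_sum]
    refine Finset.sum_le_sum fun j _ => ?_
    by_cases hj : j ∈ Finset.Iic c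
    · exact mul_le_mul_of_nonneg_right (hX.eigenvalues_antitone hn (Finset.mem_Iic.mp hj))
        (by positivity)
    · simp [repr_eq_zero_of_mem_eigenSpan hX hn hv hj]

/-- There is a subspace of dimension `i` on which the quadratic form of `X` is at most `λ_i`. -/
theorem exists_submodule_le_orderedEigenvalue (i : ℕ) (h1 : 1 ≤ i) (hi : i ≤ n) :
    ∃ U : Submodule ℂ E, finrank ℂ U = i ∧
      ∀ v ∈ U, (inner ℂ v (X v)).re ≤ orderedEigenvalue hX hn i h1 hi * ‖v‖ ^ 2 := by
  let c : Fin n := ⟨n - i, by omega⟩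
  refine ⟨eigenSpan hX hn (Finset.Ici c), ?_, fun v hv => ?_⟩
  · rw [finrank_eigenSpan, Fin.card_Ici]
    simp only [c]
    omega
  · rw [re_inner_apply_eq_sum hX hn, sq_norm_eq_sum hX hn, Finset.mul_sum]
    refine Finset.sum_le_sum fun j _ => ?_
    by_cases hj : j ∈ Finset.Ici c
    · exact mul_le_mul_of_nonneg_right (hX.eigenvalues_antitone hn (Finset.mem_Ici.mp hj))
        (by positivity)
    · simp [repr_eq_zero_of_mem_eigenSpan hX hn hv hj]

theorem exists_ne_zero_mem_inf {U W : Submodule ℂ E} (h : finrank ℂ E < finrank ℂ U + finrank ℂ W) :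
    ∃ v ∈ U, v ∈ W ∧ v ≠ 0 := by
  by_contra! hno
  have hd : Disjoint U W := Submodule.disjoint_def.mpr hno
  exact absurd (Submodule.finrank_add_finrank_le_of_disjoint hd) (by omega)

/-- If the quadratic form of `X` is at least `c ‖v‖²` on a subspace `W`, then `λ_i ≥ c` for
`i > codim W`. -/
theorem le_orderedEigenvalue {W : Submodule ℂ E} {c : ℝ}
    (hW : ∀ v ∈ W, c * ‖v‖ ^ 2 ≤ (inner ℂ v (X v)).re) {i : ℕ} (h1 : 1 ≤ i) (hi : i ≤ n)
    (hd : n < i + finrank ℂ W) : c ≤ orderedEigenvalue hX hn i h1 hi := by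
  obtain ⟨U, hU, hUle⟩ := exists_submodule_le_orderedEigenvalue hX hn i h1 hi
  obtain ⟨v, hvU, hvW, hv⟩ := exists_ne_zero_mem_inf (U := U) (W := W) (by omega)
  have : 0 < ‖v‖ ^ 2 := by positivity
  exact le_of_mul_le_mul_right ((hW v hvW).trans (hUle v hvU)) this

/-- If the quadratic form of `X` is at most `c ‖v‖²` on a subspace `W`, then `λ_i ≤ c` for
`i ≤ dim W`. -/
theorem orderedEigenvalue_le {W : Submodule ℂ E} {c : ℝ}
    (hW : ∀ v ∈ W, (inner ℂ v (X v)).re ≤ c * ‖v‖ ^ 2) {i : ℕ} (h1 : 1 ≤ i) (hi : i ≤ n)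
    (hd : i ≤ finrank ℂ W) : orderedEigenvalue hX hn i h1 hi ≤ c := by
  obtain ⟨U, hU, hUle⟩ := exists_submodule_orderedEigenvalue_le hX hn i h1 hi
  obtain ⟨v, hvU, hvW, hv⟩ := exists_ne_zero_mem_inf (U := U) (W := W) (by omega)
  have : 0 < ‖v‖ ^ 2 := by positivity
  exact le_of_mul_le_mul_right ((hUle v hvU).trans (hW v hvW)) this

end MinMax

/-! ### Bounds for the product numerical range -/

section ProductRangeBounds

open Module

variable {HK HM : Type*}
  [NormedAddCommGroup HK] [InnerProductSpace ℂ HK]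
  [NormedAddCommGroup HM] [InnerProductSpace ℂ HM]

theorem re_inner_starProjection {E : Type*} [NormedAddCommGroup E] [InnerProductSpace ℂ E]
    (W : Submodule ℂ E) [W.HasOrthogonalProjection] (v : E) :
    (inner ℂ v ((W.starProjection : E →ₗ[ℂ] E) v)).re = ‖W.starProjection v‖ ^ 2 := by
  rw [ContinuousLinearMap.coe_coe, ← inner_conj_symm, Complex.conj_re]
  exact W.re_inner_starProjection_eq_normSq v

theorem exists_unit_tmul_mem {U : Submodule ℂ (HK ⊗[ℂ] HM)}
    (h : ∃ (a : HK) (b : HM), a ≠ 0 ∧ b ≠ 0 ∧ a ⊗ₜ[ℂ] b ∈ U) :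
    ∃ (a : HK) (b : HM), ‖a‖ = 1 ∧ ‖b‖ = 1 ∧ a ⊗ₜ[ℂ] b ∈ U := by
  obtain ⟨a, b, ha, hb, hab⟩ := h
  refine ⟨((‖a‖⁻¹ : ℝ) : ℂ) • a, ((‖b‖⁻¹ : ℝ) : ℂ) • b, ?_, ?_, ?_⟩
  · simp [norm_smul, ha]
  · simp [norm_smul, hb]
  · rw [TensorProduct.smul_tmul_smul]
    exact U.smul_mem _ hab

theorem realProductRange_eq_image (X : HK ⊗[ℂ] HM →ₗ[ℂ] HK ⊗[ℂ] HM) :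
    realProductRange X =
      (fun p : HK × HM => (inner ℂ (p.1 ⊗ₜ[ℂ] p.2) (X (p.1 ⊗ₜ[ℂ] p.2))).re) ''
        (Metric.sphere 0 1 ×ˢ Metric.sphere 0 1) := by
  ext x
  simp only [realProductRange, productNumericalRange, Set.mem_image, Set.mem_ofPred_eq,
    Set.mem_prod, mem_sphere_zero_iff_norm, Prod.exists]
  constructor
  · rintro ⟨_, ⟨a, b, ha, hb, rfl⟩, rfl⟩
    exact ⟨a, b, ⟨ha, hb⟩, rfl⟩
  · rintro ⟨a, b, ⟨ha, hb⟩, rfl⟩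
    exact ⟨_, ⟨a, b, ha, hb, rfl⟩, rfl⟩

theorem mem_realProductRange (X : HK ⊗[ℂ] HM →ₗ[ℂ] HK ⊗[ℂ] HM) {a : HK} {b : HM} (ha : ‖a‖ = 1)
    (hb : ‖b‖ = 1) : (inner ℂ (a ⊗ₜ[ℂ] b) (X (a ⊗ₜ[ℂ] b))).re ∈ realProductRange X :=
  ⟨_, ⟨a, b, ha, hb, rfl⟩, rfl⟩

theorem realProductRange_nonempty (hK : 1 ≤ finrank ℂ HK) (hM : 1 ≤ finrank ℂ HM)
    (X : HK ⊗[ℂ] HM →ₗ[ℂ] HK ⊗[ℂ] HM) : (realProductRange X).Nonempty := by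
  have : Nontrivial HK := nontrivial_of_finrank_pos (R := ℂ) hK
  have : Nontrivial HM := nontrivial_of_finrank_pos (R := ℂ) hM
  obtain ⟨a, ha⟩ := exists_ne (0 : HK)
  obtain ⟨b, hb⟩ := exists_ne (0 : HM)
  obtain ⟨a, b, ha, hb, -⟩ :=
    exists_unit_tmul_mem (U := ⊤) ⟨a, b, ha, hb, Submodule.mem_top⟩
  exact ⟨_, mem_realProductRange X ha hb⟩

variable [FiniteDimensional ℂ HK] [FiniteDimensional ℂ HM]

theorem isCompact_realProductRange (X : HK ⊗[ℂ] HM →ₗ[ℂ] HK ⊗[ℂ] HM) :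
    IsCompact (realProductRange X) := by
  have : ProperSpace HK := FiniteDimensional.proper ℂ HK
  have : ProperSpace HM := FiniteDimensional.proper ℂ HM
  have hX : Continuous X := X.continuous_of_finiteDimensional
  rw [realProductRange_eq_image]
  refine ((isCompact_sphere 0 1).prod (isCompact_sphere 0 1)).image ?_
  have h : Continuous fun p : HK × HM => p.1 ⊗ₜ[ℂ] p.2 := by fun_prop
  exact Complex.continuous_re.comp (h.inner (hX.comp h))

variable {K M : ℕ} (hK : 1 ≤ K) (hM : 1 ≤ M)
  (hHK : finrank ℂ HK = K) (hHM : finrank ℂ HM = M)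

include hK hM hHK hHM

theorem isGreatest_productMax (X : HK ⊗[ℂ] HM →ₗ[ℂ] HK ⊗[ℂ] HM) :
    IsGreatest (realProductRange X) (productMax X) :=
  (isCompact_realProductRange X).isGreatest_sSup
    (realProductRange_nonempty (hHK ▸ hK) (hHM ▸ hM) X)

theorem isLeast_productMin (X : HK ⊗[ℂ] HM →ₗ[ℂ] HK ⊗[ℂ] HM) :
    IsLeast (realProductRange X) (productMin X) :=
  (isCompact_realProductRange X).isLeast_sInf
    (realProductRange_nonempty (hHK ▸ hK) (hHM ▸ hM) X)

theorem exists_unit_tmul_mem_of_lt_finrank (U : Submodule ℂ (HK ⊗[ℂ] HM))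
    (hU : (K - 1) * (M - 1) < finrank ℂ U) :
    ∃ (a : HK) (b : HM), ‖a‖ = 1 ∧ ‖b‖ = 1 ∧ a ⊗ₜ[ℂ] b ∈ U := by
  subst hHK hHM
  exact exists_unit_tmul_mem (exists_tmul_mem_of_lt_finrank hK hM U hU)

theorem orderedEigenvalue_le_productMax {X : HK ⊗[ℂ] HM →ₗ[ℂ] HK ⊗[ℂ] HM} (hX : X.IsSymmetric)
    (h1 : 1 ≤ K + M - 1) :
    orderedEigenvalue hX (finrank_tensor hHK hHM) (K + M - 1) h1 (add_sub_one_le_mul hK hM)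
      ≤ productMax X := by
  obtain ⟨U, hU, hUle⟩ := exists_submodule_orderedEigenvalue_le hX (finrank_tensor hHK hHM)
    (K + M - 1) h1 (add_sub_one_le_mul hK hM)
  obtain ⟨a, b, ha, hb, hab⟩ := exists_unit_tmul_mem_of_lt_finrank hK hM hHK hHM U (by
    rw [hU]
    obtain ⟨k, rfl⟩ := Nat.exists_eq_add_of_le' hK
    obtain ⟨m, rfl⟩ := Nat.exists_eq_add_of_le' hM
    have : (k + 1) * (m + 1) = k * m + (k + 1 + (m + 1) - 1) := by
      rw [show k + 1 + (m + 1) - 1 = k + m + 1 by omega]; ring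
    simp only [Nat.add_sub_cancel]
    omega)
  have h := hUle _ hab
  rw [TensorProduct.norm_tmul, ha, hb, one_mul, one_pow, mul_one] at h
  exact h.trans ((isGreatest_productMax hK hM hHK hHM X).2 (mem_realProductRange X ha hb))

theorem productMin_le_orderedEigenvalue {X : HK ⊗[ℂ] HM →ₗ[ℂ] HK ⊗[ℂ] HM} (hX : X.IsSymmetric)
    (h1 : 1 ≤ (K - 1) * (M - 1) + 1) :
    productMin X ≤ orderedEigenvalue hX (finrank_tensor hHK hHM) ((K - 1) * (M - 1) + 1)
      h1 (pred_mul_pred_add_one_le_mul hK hM) := by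
  obtain ⟨U, hU, hUle⟩ := exists_submodule_le_orderedEigenvalue hX (finrank_tensor hHK hHM)
    ((K - 1) * (M - 1) + 1) h1 (pred_mul_pred_add_one_le_mul hK hM)
  obtain ⟨a, b, ha, hb, hab⟩ := exists_unit_tmul_mem_of_lt_finrank hK hM hHK hHM U (by omega)
  have h := hUle _ hab
  rw [TensorProduct.norm_tmul, ha, hb, one_mul, one_pow, mul_one] at h
  exact ((isLeast_productMin hK hM hHK hHM X).2 (mem_realProductRange X ha hb)).trans h

/-- For a subspace `W` without product vectors, the projection onto `W` has product maximum less
than `1`. -/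
theorem productMax_starProjection_lt_one {W : Submodule ℂ (HK ⊗[ℂ] HM)}
    (hW : ∀ (a : HK) (b : HM), a ≠ 0 → b ≠ 0 → a ⊗ₜ[ℂ] b ∉ W) :
    productMax (W.starProjection : HK ⊗[ℂ] HM →ₗ[ℂ] HK ⊗[ℂ] HM) < 1 := by
  obtain ⟨_, ⟨a, b, ha, hb, rfl⟩, hab⟩ := (isGreatest_productMax hK hM hHK hHM
    (W.starProjection : HK ⊗[ℂ] HM →ₗ[ℂ] HK ⊗[ℂ] HM)).1
  rw [← hab]
  have hnot : a ⊗ₜ[ℂ] b ∉ W := hW a b (by rintro rfl; simp at ha) (by rintro rfl; simp at hb)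
  have h2 := Submodule.norm_sq_eq_add_norm_sq_starProjection (a ⊗ₜ[ℂ] b) W
  have h3 : 0 < ‖Wᗮ.starProjection (a ⊗ₜ[ℂ] b)‖ := by
    rw [norm_pos_iff, Ne, Submodule.starProjection_apply_eq_zero_iff,
      Submodule.orthogonal_orthogonal]
    exact hnot
  rw [TensorProduct.norm_tmul, ha, hb] at h2
  rw [re_inner_starProjection]
  nlinarith

/-- For a subspace `W` without product vectors, the projection onto the orthogonal complement of
`W` has positive product minimum. -/
theorem productMin_starProjection_orthogonal_pos {W : Submodule ℂ (HK ⊗[ℂ] HM)}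
    (hW : ∀ (a : HK) (b : HM), a ≠ 0 → b ≠ 0 → a ⊗ₜ[ℂ] b ∉ W) :
    0 < productMin (Wᗮ.starProjection : HK ⊗[ℂ] HM →ₗ[ℂ] HK ⊗[ℂ] HM) := by
  obtain ⟨_, ⟨a, b, ha, hb, rfl⟩, hab⟩ := (isLeast_productMin hK hM hHK hHM
    (Wᗮ.starProjection : HK ⊗[ℂ] HM →ₗ[ℂ] HK ⊗[ℂ] HM)).1
  rw [← hab]
  have hnot : a ⊗ₜ[ℂ] b ∉ W := hW a b (by rintro rfl; simp at ha) (by rintro rfl; simp at hb)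
  have h3 : 0 < ‖Wᗮ.starProjection (a ⊗ₜ[ℂ] b)‖ := by
    rw [norm_pos_iff, Ne, Submodule.starProjection_apply_eq_zero_iff,
      Submodule.orthogonal_orthogonal]
    exact hnot
  rw [re_inner_starProjection]
  positivity

end ProductRangeBounds

end ProductRange

theorem mainTheorem4 {HK HM : Type*}
    [NormedAddCommGroup HK] [InnerProductSpace ℂ HK] [FiniteDimensional ℂ HK]
    [NormedAddCommGroup HM] [InnerProductSpace ℂ HM] [FiniteDimensional ℂ HM]
    (K M : ℕ) (hK : 1 ≤ K) (hM : 1 ≤ M)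
    (hHK : Module.finrank ℂ HK = K) (hHM : Module.finrank ℂ HM = M) :
    (∀ (X : HK ⊗[ℂ] HM →ₗ[ℂ] HK ⊗[ℂ] HM) (hX : X.IsSymmetric),
      IsGreatest (ProductRange.realProductRange X) (ProductRange.productMax X) ∧
      IsLeast (ProductRange.realProductRange X) (ProductRange.productMin X) ∧
      ProductRange.orderedEigenvalue hX (ProductRange.finrank_tensor hHK hHM) (K + M - 1)
          (by omega) (ProductRange.add_sub_one_le_mul hK hM)
        ≤ ProductRange.productMax X ∧
      ProductRange.productMin X
        ≤ ProductRange.orderedEigenvalue hX (ProductRange.finrank_tensor hHK hHM)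
          ((K - 1) * (M - 1) + 1) (by omega) (ProductRange.pred_mul_pred_add_one_le_mul hK hM)) ∧
    (∀ (hK2 : 2 ≤ K) (hM2 : 2 ≤ M),
      (∃ (X₁ : HK ⊗[ℂ] HM →ₗ[ℂ] HK ⊗[ℂ] HM) (hX₁ : X₁.IsSymmetric),
        ProductRange.productMax X₁
          < ProductRange.orderedEigenvalue hX₁ (ProductRange.finrank_tensor hHK hHM) (K + M)
            (by omega) (ProductRange.add_le_mul_of_two_le hK2 hM2)) ∧
      (∃ (X₂ : HK ⊗[ℂ] HM →ₗ[ℂ] HK ⊗[ℂ] HM) (hX₂ : X₂.IsSymmetric),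
        ProductRange.orderedEigenvalue hX₂ (ProductRange.finrank_tensor hHK hHM)
            ((K - 1) * (M - 1)) (ProductRange.one_le_pred_mul_pred hK2 hM2)
            (ProductRange.pred_mul_pred_le_mul K M)
          < ProductRange.productMin X₂)) ∧
    (∀ (e : OrthonormalBasis (Fin K) ℂ HK) (f : OrthonormalBasis (Fin M) ℂ HM),
      Module.finrank ℂ (ProductRange.diagonalPairSpan e f) = (K - 1) * (M - 1) ∧
      ∀ (a : HK) (b : HM), a ≠ 0 → b ≠ 0 →
        a ⊗ₜ[ℂ] b ∉ ProductRange.diagonalPairSpan e f) := by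
  refine ⟨fun X hX => ⟨ProductRange.isGreatest_productMax hK hM hHK hHM X,
    ProductRange.isLeast_productMin hK hM hHK hHM X,
    ProductRange.orderedEigenvalue_le_productMax hK hM hHK hHM hX _,
    ProductRange.productMin_le_orderedEigenvalue hK hM hHK hHM hX _⟩, fun hK2 hM2 => ?_,
    fun e f => ⟨ProductRange.finrank_diagonalPairSpan e f hK hM,
      fun _ _ ha hb => ProductRange.tmul_notMem_diagonalPairSpan e f ha hb⟩⟩
  let e := (stdOrthonormalBasis ℂ HK).reindex (finCongr hHK)
  let f := (stdOrthonormalBasis ℂ HM).reindex (finCongr hHM)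
  let W := ProductRange.diagonalPairSpan e f
  have hdim : Module.finrank ℂ W = (K - 1) * (M - 1) :=
    ProductRange.finrank_diagonalPairSpan e f hK hM
  have hprod (a : HK) (b : HM) (ha : a ≠ 0) (hb : b ≠ 0) : a ⊗ₜ[ℂ] b ∉ W :=
    ProductRange.tmul_notMem_diagonalPairSpan e f ha hb
  constructor
  -- the projection onto `W` is the identity on `W`, whose dimension exceeds `K M - (K + M)`
  · refine ⟨W.starProjection, W.starProjection_isSymmetric, ?_⟩
    refine (ProductRange.productMax_starProjection_lt_one hK hM hHK hHM hprod).trans_le ?_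
    refine ProductRange.le_orderedEigenvalue _ _ (W := W) (fun v hv => ?_) _ _ ?_
    · rw [ContinuousLinearMap.coe_coe, Submodule.starProjection_eq_self_iff.mpr hv, one_mul]
      exact (norm_sq_eq_re_inner (𝕜 := ℂ) v).le
    · rw [hdim]
      obtain ⟨k, rfl⟩ := Nat.exists_eq_add_of_le' hK
      obtain ⟨m, rfl⟩ := Nat.exists_eq_add_of_le' hM
      simp only [Nat.add_sub_cancel]
      nlinarith
  -- the projection onto `Wᗮ` vanishes on `W`, whose dimension is `(K - 1) (M - 1)`
  · refine ⟨Wᗮ.starProjection, Wᗮ.starProjection_isSymmetric, ?_⟩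
    refine lt_of_le_of_lt ?_
      (ProductRange.productMin_starProjection_orthogonal_pos hK hM hHK hHM hprod)
    refine ProductRange.orderedEigenvalue_le _ _ (W := W) (fun v hv => ?_) _ _ hdim.ge
    have h0 : Wᗮ.starProjection v = 0 := by
      rw [Submodule.starProjection_apply_eq_zero_iff, Submodule.orthogonal_orthogonal]
      exact hv
    simp [h0]
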